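/- Let $n>1$ be an integer, let $\omega=e^{2\pi i/n}$, and let $\varepsilon>0$ be a real number. For a real number $x$ write $\{x\}=x-\lfloor x\rfloor$ for its fractional part. Then there is $X\in\mathbb{C}$ such that $\{\operatorname{Re}(X\omega^k)\}\in(\varepsilon,1-\varepsilon)$ for all integers $k$ with $1\le k\le n$ if and only if 1. $\varepsilon<\frac{p-1}{2p}$, when $n$ is not a power of $2$ and $p$ is the smallest odd prime dividing $n$; 2. $\varepsilon<\frac12$, when $n$ is a power of $2$. -/

import Mathlib

/-!
The bound is necessary because over a coset of the `p`-th roots of unity the numbers `Re (X ωᵏ)`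
sum to zero: the `p` fractional parts have an integral sum, which cannot lie strictly between
`(p - 1) / 2` and `(p + 1) / 2` (`lt_of_fract_mem_Ioo`).

For sufficiency, look for integers `τₖ` such that `∑ aₖ τₖ ≡ 0` modulo `p` for every integral
relation `∑ aₖ ωᵏ = 0`, and such that `τₖ / p` is as close to `1 / 2` as possible. The rest is an
approximation `Re (X ωᵏ) ≈ τₖ / p` modulo `1`, uniform in `k` (`exists_re_mul_pow_near`). Instead
of Kronecker's theorem it uses that the target is a torsion point. Nondegeneracy of the trace form
gives `c` in the cyclotomic field with `Tr (c ζᵏ) ≡ τₖ` modulo `p`; Dirichlet's unit theorem gives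
an integer `v ≡ 1` modulo `p` all of whose conjugates, except those at the place of the chosen
embedding, have absolute value below `1`. Then `Tr (c vʲ ζᵏ) / p` is still `τₖ / p` modulo `1`,
and for large `j` it is almost a fixed multiple of the real part of a single conjugate.

If `n` is a power of `2`, take `τₖ = 1` and the modulus `2`: the cyclotomic polynomial is `2` at `1`.
Otherwise let `p` be the smallest odd prime factor of `n` and `τₖ = (p + sₖ) / 2` with signs `sₖ`.
The condition becomes `∑ aₖ sₖ ≡ 0` modulo `p`. With `m` the prime-to-`p` part of `n`, it
suffices that `s` has period `m` and that its sums over the cosets of subgroups of prime order in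
`ℤ/m` vanish modulo `p` (`seqPairing.cyclotomic_mem_recurrenceIdeal`). A product over the primes
`q ∣ m` of sign functions of one base-`q` digit does this, provided each of them has sum `0` or `p`
over `ℤ/q`; such signs exist as `q = 2` or `q > p` (`exists_signs_periodic`).
-/

/-! ### Sequences killed by a cyclotomic polynomial -/

open Polynomial in
/-- The pairing `∑ cₖ Xᵏ ↦ ∑ cₖ sₖ` of a polynomial with a sequence `s`. -/
noncomputable def seqPairing {R : Type*} [CommRing R] (s : ℕ → R) : R[X] →ₗ[R] R :=
  Polynomial.lsum fun k => LinearMap.toSpanSingleton R R (s k)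

namespace seqPairing

open Polynomial

variable {R S : Type*} [CommRing R] [CommRing S]

@[simp]
theorem monomial_apply (s : ℕ → R) (k : ℕ) (c : R) : seqPairing s (monomial k c) = c * s k := by
  simp [seqPairing, Polynomial.lsum_apply]

@[simp]
theorem X_pow_apply (s : ℕ → R) (k : ℕ) : seqPairing s (X ^ k) = s k := by
  rw [X_pow_eq_monomial, monomial_apply, one_mul]

theorem map_apply (φ : R →+* S) (s : ℕ → R) (f : R[X]) :
    seqPairing (fun k => φ (s k)) (f.map φ) = φ (seqPairing s f) := by
  induction f using Polynomial.induction_on' with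
  | add f g hf hg => simp [hf, hg]
  | monomial k c => simp

theorem add_apply (s t : ℕ → R) (f : R[X]) :
    seqPairing (fun k => s k + t k) f = seqPairing s f + seqPairing t f := by
  induction f using Polynomial.induction_on' with
  | add f g hf hg => simp only [map_add, hf, hg]; ring
  | monomial k c => simp [mul_add]

theorem const_mul_apply (a : R) (s : ℕ → R) (f : R[X]) :
    seqPairing (fun k => a * s k) f = a * seqPairing s f := by
  induction f using Polynomial.induction_on' with
  | add f g hf hg => simp only [map_add, hf, hg]; ring
  | monomial k c => simp; ring

theorem one_apply (f : R[X]) : seqPairing (fun _ => (1 : R)) f = f.eval 1 := by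
  induction f using Polynomial.induction_on' with
  | add f g hf hg => simp [hf, hg]
  | monomial k c => simp

/-- The ideal of polynomials `f` that, read as linear recurrences, are satisfied by `s`. -/
def recurrenceIdeal (s : ℕ → R) : Ideal R[X] where
  carrier := {f | ∀ g, seqPairing s (f * g) = 0}
  zero_mem' := by simp
  add_mem' := by
    intro a b ha hb g
    rw [add_mul, map_add, ha, hb, add_zero]
  smul_mem' := by
    intro c f hf g
    rw [smul_eq_mul, mul_comm c, mul_assoc]
    exact hf _

theorem mem_recurrenceIdeal {s : ℕ → R} {f : R[X]} :
    f ∈ recurrenceIdeal s ↔ ∀ k, seqPairing s (f * X ^ k) = 0 := by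
  refine ⟨fun h k => h _, fun h g => ?_⟩
  induction g using Polynomial.induction_on' with
  | add a b ha hb => rw [mul_add, map_add, ha, hb, add_zero]
  | monomial k c =>
    rw [← C_mul_X_pow_eq_monomial, mul_left_comm, ← smul_eq_C_mul, map_smul, h, smul_zero]

theorem apply_eq_zero_of_mem {s : ℕ → R} {f : R[X]} (h : f ∈ recurrenceIdeal s) :
    seqPairing s f = 0 := by
  simpa using h 1

/-- If an `m`-periodic sequence sums to zero along every coset of every subgroup of prime order
`q` of `ℤ/m`, and all these `q` are invertible, then it is killed by the `m`-th cyclotomic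
polynomial. Modulo the recurrence ideal, `∑_{j<q} X^{jm/q} = 0` turns `X^{m/q} - 1` into a divisor
of the unit `q`, so that all the other cyclotomic factors of `X^m - 1` become invertible. -/
theorem cyclotomic_mem_recurrenceIdeal {s : ℕ → R} {m : ℕ} (hm : 0 < m)
    (hper : ∀ k, s (k + m) = s k)
    (hunit : ∀ q : ℕ, q.Prime → q ∣ m → IsUnit (q : R))
    (hsum : ∀ q : ℕ, q.Prime → q ∣ m → ∀ k, ∑ j ∈ Finset.range q, s (k + j * (m / q)) = 0) :
    cyclotomic m R ∈ recurrenceIdeal s := by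
  have hX : X ^ m - 1 ∈ recurrenceIdeal s := by
    rw [mem_recurrenceIdeal]
    intro k
    rw [sub_mul, one_mul, map_sub, ← pow_add, X_pow_apply, X_pow_apply, add_comm, hper, sub_self]
  have hgeom : ∀ q : ℕ, q.Prime → q ∣ m →
      ∑ j ∈ Finset.range q, (X ^ (m / q)) ^ j ∈ recurrenceIdeal s := by
    intro q hq hqm
    rw [mem_recurrenceIdeal]
    intro k
    rw [Finset.sum_mul, map_sum, ← hsum q hq hqm k]
    refine Finset.sum_congr rfl fun j _ => ?_
    rw [← pow_mul, ← pow_add, X_pow_apply, add_comm, mul_comm]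
  have hd : ∀ d ∈ m.properDivisors,
      IsUnit (Ideal.Quotient.mk (recurrenceIdeal s) (cyclotomic d R)) := by
    intro d hd
    rw [Nat.mem_properDivisors] at hd
    obtain ⟨⟨e, rfl⟩, hlt⟩ := hd
    have he : e ≠ 1 := by rintro rfl; simp at hlt
    obtain ⟨q, hq, f, rfl⟩ := Nat.exists_prime_and_dvd he
    have hqm : q ∣ d * (q * f) := ⟨d * f, by ring⟩
    have hr : d * (q * f) / q = d * f :=
      Nat.div_eq_of_eq_mul_right hq.pos (by ring)
    have h1 : cyclotomic d R ∣ (q : R[X]) - ∑ j ∈ Finset.range q, (X ^ (d * f)) ^ j := by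
      have h2 : cyclotomic d R ∣ 1 - X ^ (d * f) := by
        rw [← dvd_neg, neg_sub]
        refine (cyclotomic.dvd_X_pow_sub_one d R).trans ?_
        simpa [pow_mul] using sub_one_dvd_pow_sub_one (X ^ d : R[X]) f
      have h3 : (q : R[X]) - ∑ j ∈ Finset.range q, (X ^ (d * f)) ^ j
          = ∑ j ∈ Finset.range q, (1 - (X ^ (d * f)) ^ j) := by
        simp
      rw [h3]
      refine Finset.dvd_sum fun j _ => h2.trans ?_
      simpa using sub_dvd_pow_sub_pow (1 : R[X]) (X ^ (d * f)) j
    refine isUnit_of_dvd_unit (map_dvd (Ideal.Quotient.mk (recurrenceIdeal s)) h1) ?_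
    have h4 := hgeom q hq hqm
    rw [hr] at h4
    rw [map_sub, Ideal.Quotient.eq_zero_iff_mem.2 h4, sub_zero]
    have h5 := ((hunit q hq hqm).map (C : R →+* R[X])).map (Ideal.Quotient.mk (recurrenceIdeal s))
    simpa using h5
  have hprod := prod_cyclotomic_eq_X_pow_sub_one hm R
  rw [← Nat.insert_self_properDivisors hm.ne',
    Finset.prod_insert Nat.self_notMem_properDivisors] at hprod
  rw [← hprod] at hX
  rw [← Ideal.Quotient.eq_zero_iff_mem] at hX ⊢
  rw [map_mul, map_prod] at hX
  have hu : IsUnit (∏ d ∈ m.properDivisors,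
      Ideal.Quotient.mk (recurrenceIdeal s) (cyclotomic d R)) :=
    (IsUnit.prod_iff).2 hd
  exact (hu.mul_left_eq_zero).1 hX

end seqPairing

/-! ### Approximation at torsion points -/

section Approximation

open Polynomial NumberField

variable {n : ℕ} [NeZero n] {K : Type*} [Field K] [NumberField K] [IsCyclotomicExtension {n} ℚ K]
  {ζ : K}

/-- A sequence which is compatible modulo `p` with all integral relations between the powers of
`ζ` is, modulo `p`, the sequence of traces `Tr (c ζᵏ)` for some `c`. -/
theorem exists_trace_mul_aeval_eq (hζ : IsPrimitiveRoot ζ n) (p : ℤ) (τ : ℕ → ℤ)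
    (hτ : ∀ f : ℤ[X], cyclotomic n ℤ ∣ f → p ∣ seqPairing τ f) :
    ∃ c : K, ∀ f : ℤ[X], ∃ z : ℤ,
      Algebra.trace ℚ K (c * aeval ζ f) = (seqPairing τ f : ℚ) + p * z := by
  set pb := hζ.powerBasis ℚ with hpb
  have hgen : pb.gen = ζ := hζ.powerBasis_gen ℚ
  have hn : 0 < n := NeZero.pos n
  have hdim : pb.dim = (cyclotomic n ℤ).natDegree := by
    rw [← pb.natDegree_minpoly, hgen, ← cyclotomic_eq_minpoly_rat hζ hn, natDegree_cyclotomic,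
      natDegree_cyclotomic]
  let l : K →ₗ[ℚ] ℚ := pb.basis.constr ℚ fun i => (τ i : ℚ)
  have hl : ∀ k < pb.dim, l (ζ ^ k) = τ k := by
    intro k hk
    have h := pb.basis.constr_basis ℚ (fun i => (τ i : ℚ)) ⟨k, hk⟩
    rwa [pb.basis_eq_pow, hgen] at h
  have hlow : ∀ r : ℤ[X], r.natDegree < pb.dim → l (aeval ζ r) = (seqPairing τ r : ℚ) := by
    intro r hr
    rw [aeval_eq_sum_range' hr, map_sum]
    conv_rhs => rw [as_sum_range' r _ hr]
    rw [map_sum, Int.cast_sum]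
    refine Finset.sum_congr rfl fun k hk => ?_
    rw [map_zsmul, hl k (Finset.mem_range.1 hk)]
    simp
  have hB := traceForm_nondegenerate ℚ K
  refine ⟨((Algebra.traceForm ℚ K).toDual hB).symm l, fun f => ?_⟩
  have hc : ∀ y, Algebra.trace ℚ K (((Algebra.traceForm ℚ K).toDual hB).symm l * y) = l y :=
    fun y => LinearMap.BilinForm.apply_toDual_symm_apply (hB := hB) l y
  have hmon := cyclotomic.monic n ℤ
  have hne : cyclotomic n ℤ ≠ 1 := by
    intro h
    have := natDegree_cyclotomic n ℤ
    rw [h, natDegree_one] at this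
    exact (Nat.totient_pos.2 hn).ne this
  have hroot : aeval ζ (cyclotomic n ℤ) = 0 := by
    have := hζ.isRoot_cyclotomic hn
    rw [IsRoot.def, ← map_cyclotomic_int, eval_map] at this
    rwa [aeval_def]
  have hdiv := modByMonic_add_div f (cyclotomic n ℤ)
  obtain ⟨z, hz⟩ := hτ (cyclotomic n ℤ * (f /ₘ cyclotomic n ℤ)) (dvd_mul_right _ _)
  refine ⟨-z, ?_⟩
  have h1 : aeval ζ f = aeval ζ (f %ₘ cyclotomic n ℤ) := by
    conv_lhs => rw [← hdiv]
    simp [hroot]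
  have h2 : seqPairing τ f = seqPairing τ (f %ₘ cyclotomic n ℤ) + p * z := by
    conv_lhs => rw [← hdiv]
    rw [map_add, hz]
  rw [hc, h1, hlow _ (hdim ▸ natDegree_modByMonic_lt f hmon hne), h2]
  push_cast
  ring

/-- Every integer of the cyclotomic field is an integral polynomial in `ζ`. -/
theorem exists_aeval_eq_ringOfIntegers (hζ : IsPrimitiveRoot ζ n) (y : 𝓞 K) :
    ∃ g : ℤ[X], aeval ζ g = (y : K) := by
  have := IsCyclotomicExtension.Rat.isIntegralClosure_adjoin_singleton hζ
  obtain ⟨w, hw⟩ := (IsIntegralClosure.isIntegral_iff (A := Algebra.adjoin ℤ ({ζ} : Set K))).1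
    y.isIntegral_coe
  obtain ⟨g, hg⟩ := (Algebra.adjoin_singleton_eq_range_aeval ℤ ζ).le w.2
  exact ⟨g, hg.trans hw⟩

/-- An analogue of a Pisot number that is `1` modulo `p`: a unit of small absolute value at all the
infinite places but one, by Dirichlet's unit theorem, raised to its order modulo `p`. -/
theorem exists_small_congr_one (w₀ : InfinitePlace K) {p : ℕ} (hp : p ≠ 0) :
    ∃ v : 𝓞 K, (∀ w : InfinitePlace K, w ≠ w₀ → w (v : K) < 1) ∧ (p : 𝓞 K) ∣ v - 1 := by
  obtain ⟨u, hu⟩ := Units.dirichletUnitTheorem.exists_unit K w₀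
  have hI : Ideal.span {(p : 𝓞 K)} ≠ ⊥ := by
    rw [Ne, Ideal.span_singleton_eq_bot]
    exact_mod_cast hp
  have := Ideal.finiteQuotientOfFreeOfNeBot _ hI
  let u' : (𝓞 K ⧸ Ideal.span {(p : 𝓞 K)})ˣ :=
    Units.map (Ideal.Quotient.mk (Ideal.span {(p : 𝓞 K)})).toMonoidHom u
  have hfin := isOfFinOrder_of_finite u'
  obtain ⟨e, he, hue⟩ := isOfFinOrder_iff_pow_eq_one.1 hfin
  refine ⟨(u : 𝓞 K) ^ e, fun w hw => ?_, ?_⟩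
  · have hpos : 0 < w ((u : 𝓞 K) : K) :=
      InfinitePlace.pos_iff.2 (RingOfIntegers.coe_ne_zero_iff.2 u.ne_zero)
    have hlt : w ((u : 𝓞 K) : K) < 1 := (Real.log_neg_iff hpos).1 (hu w hw)
    rw [RingOfIntegers.coe_eq_algebraMap, map_pow, map_pow]
    exact pow_lt_one₀ hpos.le hlt he.ne'
  · rw [← Ideal.mem_span_singleton, ← Ideal.Quotient.eq_zero_iff_mem, map_sub, map_pow, map_one,
      sub_eq_zero]
    simpa [u', Units.ext_iff] using hue

/-- The trace splits into the part coming from the place `w₀` of a given embedding and the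
remaining embeddings. -/
theorem trace_eq_card_mul_re_add_sum (φ : K →+* ℂ) (x : K) :
    open scoped Classical in
    ((Algebra.trace ℚ K x : ℚ) : ℝ) =
      (Finset.univ.filter fun σ : K →+* ℂ => InfinitePlace.mk σ = InfinitePlace.mk φ).card
        * (φ x).re +
      ∑ σ : K →+* ℂ with InfinitePlace.mk σ ≠ InfinitePlace.mk φ, (σ x).re := by
  classical
  have h : ((Algebra.trace ℚ K x : ℚ) : ℂ) = ∑ σ : K →+* ℂ, σ x := by
    have := trace_eq_sum_embeddings (K := ℚ) (L := K) ℂ (x := x)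
    rw [eq_ratCast] at this
    rw [this]
    exact (Fintype.sum_equiv (RingHom.equivRatAlgHom K ℂ) _ _ fun σ => rfl).symm
  have h2 := congrArg Complex.re h
  rw [Complex.ratCast_re, Complex.re_sum] at h2
  rw [h2, ← Finset.sum_filter_add_sum_filter_not Finset.univ
    (fun σ : K →+* ℂ => InfinitePlace.mk σ = InfinitePlace.mk φ)]
  congr 1
  rw [← nsmul_eq_mul]
  refine Finset.sum_eq_card_nsmul fun σ hσ => ?_
  rw [Finset.mem_filter] at hσ
  rcases InfinitePlace.mk_eq_iff.1 hσ.2 with h | h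
  · rw [h]
  · rw [← h]
    simp

/-- A Kronecker-type approximation theorem at rational points. If `τ` is compatible modulo `p`
with the integral relations between the powers of `ζ`, then the numbers `Re (X φ(ζ)ᵏ)` can be brought
simultaneously and arbitrarily close to `τₖ / p` modulo `1`.
With `Tr (c ζᵏ) ≡ τₖ` and `v` as in `exists_small_congr_one`, the traces `Tr (c vʲ ζᵏ)` have the
same residues modulo `p`, whereas for large `j` the embeddings outside the place of `φ`
contribute almost nothing to them. -/
theorem exists_re_mul_map_pow_near (hζ : IsPrimitiveRoot ζ n) (φ : K →+* ℂ) {p : ℕ}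
    (hp : 0 < p) (τ : ℕ → ℤ)
    (hτ : ∀ f : ℤ[X], cyclotomic n ℤ ∣ f → (p : ℤ) ∣ seqPairing τ f) {δ : ℝ} (hδ : 0 < δ) :
    ∃ X : ℂ, ∀ k, ∃ z : ℤ, |(X * φ ζ ^ k).re - (τ k : ℝ) / p - z| < δ := by
  classical
  have hn : 0 < n := NeZero.pos n
  obtain ⟨c, hc⟩ := exists_trace_mul_aeval_eq hζ (p : ℤ) τ hτ
  obtain ⟨v, hv, hv1⟩ := exists_small_congr_one (InfinitePlace.mk φ) hp.ne'
  have hlim : Filter.Tendsto (fun j : ℕ =>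
      ∑ σ : K →+* ℂ with InfinitePlace.mk σ ≠ InfinitePlace.mk φ, ‖σ c‖ * ‖σ (v : K)‖ ^ j)
      Filter.atTop (nhds 0) := by
    rw [show (0 : ℝ) = ∑ σ : K →+* ℂ with InfinitePlace.mk σ ≠ InfinitePlace.mk φ, ‖σ c‖ * 0 by
      simp]
    refine tendsto_finsetSum _ fun σ hσ => (tendsto_pow_atTop_nhds_zero_of_lt_one
      (norm_nonneg _) ?_).const_mul _
    exact hv (InfinitePlace.mk σ) (Finset.mem_filter.1 hσ).2
  have hpR : (0 : ℝ) < p := Nat.cast_pos.2 hp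
  obtain ⟨j, hj⟩ := ((hlim.eventually (gt_mem_nhds (mul_pos hδ hpR)))).exists
  obtain ⟨y, hy⟩ : (p : 𝓞 K) ∣ v ^ j - 1 :=
    hv1.trans (by simpa using sub_one_dvd_pow_sub_one v j)
  obtain ⟨g, hg⟩ := exists_aeval_eq_ringOfIntegers hζ y
  have hvj : (v : K) ^ j = 1 + p * aeval ζ g := by
    have := congrArg (algebraMap (𝓞 K) K) hy
    rw [map_sub, map_pow, map_mul, map_natCast, map_one,
      ← RingOfIntegers.coe_eq_algebraMap y, ← hg] at this
    exact sub_eq_iff_eq_add'.1 this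
  set M := (Finset.univ.filter fun σ : K →+* ℂ => InfinitePlace.mk σ = InfinitePlace.mk φ).card
  refine ⟨M * φ (c * (v : K) ^ j) / p, fun k => ?_⟩
  obtain ⟨z₁, hz₁⟩ := hc (X ^ k)
  obtain ⟨z₂, hz₂⟩ := hc (g * X ^ k)
  rw [map_mul (aeval ζ), aeval_X_pow] at hz₂
  rw [aeval_X_pow, seqPairing.X_pow_apply] at hz₁
  have htr : Algebra.trace ℚ K (c * (v : K) ^ j * ζ ^ k) =
      τ k + p * (z₁ + (seqPairing τ (g * X ^ k) + p * z₂) : ℤ) := by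
    have : c * (v : K) ^ j * ζ ^ k = c * ζ ^ k + (p : ℚ) • (c * (aeval ζ g * ζ ^ k)) := by
      rw [hvj, Algebra.smul_def, map_natCast]
      ring
    rw [this, map_add, map_smul, hz₁, hz₂]
    push_cast
    rw [smul_eq_mul]
    ring
  refine ⟨z₁ + (seqPairing τ (g * X ^ k) + p * z₂), ?_⟩
  generalize z₁ + (seqPairing τ (g * X ^ k) + p * z₂) = z at htr
  have hsplit := trace_eq_card_mul_re_add_sum φ (c * (v : K) ^ j * ζ ^ k)
  rw [htr] at hsplit
  set E := ∑ σ : K →+* ℂ with InfinitePlace.mk σ ≠ InfinitePlace.mk φ,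
    (σ (c * (v : K) ^ j * ζ ^ k)).re
  have hE : |E| < δ * p := by
    refine lt_of_le_of_lt ((Finset.abs_sum_le_sum_abs _ _).trans
      (Finset.sum_le_sum fun σ _ => (Complex.abs_re_le_norm _).trans_eq ?_)) hj
    have h1 : ‖σ ζ‖ = 1 := (hζ.map_of_injective σ.injective).norm'_eq_one hn.ne'
    rw [map_mul, map_mul, map_pow, map_pow, norm_mul, norm_mul, norm_pow, norm_pow, h1, one_pow,
      mul_one]
  have hre : (M * φ (c * (v : K) ^ j) / p * φ ζ ^ k).re =
      M * (φ (c * (v : K) ^ j * ζ ^ k)).re / p := by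
    rw [map_mul φ _ (ζ ^ k), map_pow φ ζ]
    rw [show (M * φ (c * (v : K) ^ j) / p * φ ζ ^ k : ℂ) =
      ((M / p : ℝ) : ℂ) * (φ (c * (v : K) ^ j) * φ ζ ^ k) by push_cast; ring]
    rw [Complex.re_ofReal_mul]
    ring
  rw [hre]
  push_cast at hsplit
  have : (M : ℝ) * (φ (c * (v : K) ^ j * ζ ^ k)).re / p - (τ k : ℝ) / p - z = -E / p := by
    field_simp
    linarith
  rw [this, abs_div, abs_neg, abs_of_pos hpR, div_lt_iff₀ hpR]
  exact hE

end Approximation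

open Polynomial in
/-- The approximation `exists_re_mul_map_pow_near` for an arbitrary complex primitive root of unity. -/
theorem exists_re_mul_pow_near {n : ℕ} (hn : 0 < n) {ω : ℂ} (hω : IsPrimitiveRoot ω n) {p : ℕ}
    (hp : 0 < p) (τ : ℕ → ℤ)
    (hτ : ∀ f : ℤ[X], cyclotomic n ℤ ∣ f → (p : ℤ) ∣ seqPairing τ f) {δ : ℝ} (hδ : 0 < δ) :
    ∃ X : ℂ, ∀ k, ∃ z : ℤ, |(X * ω ^ k).re - (τ k : ℝ) / p - z| < δ := by
  have : NeZero n := ⟨hn.ne'⟩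
  -- The default `ℚ`-algebra structure of `CyclotomicField n ℚ` is only propositionally equal to
  -- the one it carries as a splitting field.
  have : IsCyclotomicExtension {n} ℚ (CyclotomicField n ℚ) := by
    have h : (DivisionRing.toRatAlgebra : Algebra ℚ (CyclotomicField n ℚ)) =
      CyclotomicField.algebra n ℚ := Subsingleton.elim _ _
    rw [h]
    exact CyclotomicField.isCyclotomicExtension n ℚ
  obtain ⟨φ⟩ : Nonempty (CyclotomicField n ℚ →+* ℂ) := inferInstance
  have hz := IsCyclotomicExtension.zeta_spec n ℚ (CyclotomicField n ℚ)
  have hz' := hz.map_of_injective φ.injective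
  obtain ⟨i, -, hi⟩ := hz'.eq_pow_of_pow_eq_one hω.pow_eq_one
  rw [← map_pow] at hi
  rw [← hi] at hω ⊢
  exact exists_re_mul_map_pow_near (IsPrimitiveRoot.of_map_of_injective hω φ.injective) φ hp τ hτ hδ

/-! ### Construction of the residues -/

/-- Signs on `ℤ/q` with sum divisible by `p`: of the `q` signs, one is positive for `q = 2`, and
`(q + p) / 2` for odd `q ≥ p`. -/
theorem exists_signs_dvd_sum {p q : ℕ} (hp : Odd p) [NeZero q] (hq : q = 2 ∨ (Odd q ∧ p ≤ q)) :
    ∃ s : ZMod q → ℤ, (∀ i, s i = 1 ∨ s i = -1) ∧ (p : ℤ) ∣ ∑ i, s i := by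
  classical
  obtain ⟨h, hh, hd⟩ : ∃ h ≤ q, (p : ℤ) ∣ 2 * h - q := by
    rcases hq with rfl | ⟨hq, hpq⟩
    · exact ⟨1, by norm_num, by norm_num⟩
    · obtain ⟨h, hh⟩ := (hq.add_odd hp).two_dvd
      refine ⟨h, by omega, 1, ?_⟩
      have : (q : ℤ) + p = 2 * h := by exact_mod_cast hh
      linarith
  obtain ⟨A, -, hA⟩ := Finset.exists_subset_card_eq (s := (Finset.univ : Finset (ZMod q)))
    (n := h) (by rw [Finset.card_univ, ZMod.card]; exact hh)
  refine ⟨fun i => if i ∈ A then 1 else -1, fun i => by by_cases hi : i ∈ A <;> simp [hi], ?_⟩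
  have : ∑ i : ZMod q, (if i ∈ A then (1 : ℤ) else -1) = ∑ i, (2 * (if i ∈ A then 1 else 0) - 1) :=
    Finset.sum_congr rfl fun i _ => by split_ifs <;> norm_num
  rw [this, Finset.sum_sub_distrib, ← Finset.mul_sum, Finset.sum_boole]
  simpa [hA, ZMod.card] using hd

/-- An affine map with invertible slope permutes `ℤ/q`. -/
theorem ZMod.sum_range_add_mul {M : Type*} [AddCommMonoid M] {q : ℕ} [NeZero q]
    (s : ZMod q → M) (a : ZMod q) {u : ZMod q} (hu : IsUnit u) :
    ∑ j ∈ Finset.range q, s (a + j * u) = ∑ i, s i := by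
  have h1 : ∑ i : ZMod q, s (a + i * u) = ∑ i, s i :=
    Fintype.sum_equiv (hu.unit.mulRight.trans (Equiv.addLeft a)) _ _ fun i => by simp
  rw [← h1]
  refine Finset.sum_bij (fun j _ => (j : ZMod q)) (fun _ _ => Finset.mem_univ _) ?_ ?_ ?_
  · intro i hi j hj hij
    rw [Finset.mem_range] at hi hj
    rw [ZMod.natCast_eq_natCast_iff'] at hij
    rwa [Nat.mod_eq_of_lt hi, Nat.mod_eq_of_lt hj] at hij
  · intro b _
    exact ⟨b.val, Finset.mem_range.2 b.val_lt, ZMod.natCast_zmod_val b⟩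
  · simp

/-- The digit of `k` in base `q` at the place just below the exact power of `q` dividing `m`: the
coordinate on `ℤ/m` that tells apart the elements of a coset of the subgroup of order `q`. -/
def topDigit (m q k : ℕ) : ZMod q := (k / q ^ (m.factorization q - 1) : ℕ)

theorem topDigit_add {m q : ℕ} (hq : 0 < q) (k u : ℕ) :
    topDigit m q (k + q ^ (m.factorization q - 1) * u) = topDigit m q k + u := by
  rw [topDigit, Nat.add_mul_div_left _ _ (Nat.pow_pos hq), Nat.cast_add, topDigit]

theorem topDigit_add_of_dvd {m q : ℕ} (hq : q.Prime) (hqm : m.factorization q ≠ 0)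
    (k : ℕ) {t : ℕ} (ht : q ^ m.factorization q ∣ t) : topDigit m q (k + t) = topDigit m q k := by
  obtain ⟨u, rfl⟩ := ht
  obtain ⟨v, hv⟩ := Nat.exists_eq_succ_of_ne_zero hqm
  have : q ^ m.factorization q * u = q ^ (m.factorization q - 1) * (q * u) := by
    rw [hv, Nat.succ_eq_add_one, Nat.add_sub_cancel, pow_succ, mul_assoc]
  rw [this, topDigit_add hq.pos]
  simp

/-- A product over the primes `q ∣ m` of sign functions of the top `q`-digit has all its sums over
cosets of subgroups of prime order divisible by `p`, since along such a coset only one factor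
varies, and runs once over all its values. -/
theorem exists_signs_periodic {p m : ℕ} (hp : Odd p) (hm : 0 < m)
    (hmp : ∀ q : ℕ, q.Prime → q ∣ m → q = 2 ∨ (Odd q ∧ p ≤ q)) :
    ∃ s : ℕ → ℤ, (∀ k, s k = 1 ∨ s k = -1) ∧ (∀ k, s (k + m) = s k) ∧
      ∀ q : ℕ, q.Prime → q ∣ m → ∀ k,
        (p : ℤ) ∣ ∑ j ∈ Finset.range q, s (k + j * (m / q)) := by
  have hex : ∀ q : ℕ, ∃ s : ZMod q → ℤ, (∀ i, s i = 1 ∨ s i = -1) ∧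
      (q.Prime → q ∣ m → ∀ (a u : ZMod q), IsUnit u →
        (p : ℤ) ∣ ∑ j ∈ Finset.range q, s (a + j * u)) := by
    intro q
    by_cases h : q.Prime ∧ q ∣ m
    · have : NeZero q := ⟨h.1.ne_zero⟩
      obtain ⟨s, h1, h2⟩ := exists_signs_dvd_sum hp (hmp q h.1 h.2)
      exact ⟨s, h1, fun _ _ a u hu => by rwa [ZMod.sum_range_add_mul s a hu]⟩
    · exact ⟨fun _ => 1, fun _ => Or.inl rfl, fun h1 h2 => absurd ⟨h1, h2⟩ h⟩
  choose s hs hsum using hex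
  have hfac : ∀ q ∈ m.primeFactors, m.factorization q ≠ 0 := fun q hq =>
    Finsupp.mem_support_iff.1 (by rwa [Nat.support_factorization])
  refine ⟨fun k => ∏ q ∈ m.primeFactors, s q (topDigit m q k), fun k => ?_, fun k => ?_, ?_⟩
  · refine Finset.prod_induction _ (fun x : ℤ => x = 1 ∨ x = -1) ?_ (Or.inl rfl)
      fun q _ => hs q _
    rintro a b (rfl | rfl) (rfl | rfl) <;> simp
  · refine Finset.prod_congr rfl fun q hq => ?_
    rw [topDigit_add_of_dvd (Nat.prime_of_mem_primeFactors hq) (hfac q hq) k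
      (Nat.ordProj_dvd m q)]
  · intro q hq hqm k
    have hmem : q ∈ m.primeFactors := Nat.mem_primeFactors.2 ⟨hq, hqm, hm.ne'⟩
    obtain ⟨v, hv⟩ := Nat.exists_eq_succ_of_ne_zero (hfac q hmem)
    set u := m / q ^ m.factorization q with hu
    have hmu : m = q ^ m.factorization q * u := (Nat.ordProj_mul_ordCompl_eq_self m q).symm
    have hmq : m / q = q ^ (m.factorization q - 1) * u := by
      refine Nat.div_eq_of_eq_mul_right hq.pos ?_
      conv_lhs => rw [hmu]
      rw [hv, Nat.succ_eq_add_one, Nat.add_sub_cancel, pow_succ]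
      ring
    have hunit : IsUnit (u : ZMod q) :=
      (ZMod.isUnit_iff_coprime u q).2 (Nat.coprime_ordCompl hq hm.ne').symm
    have hother : ∀ r ∈ m.primeFactors.erase q, ∀ j,
        topDigit m r (k + j * (m / q)) = topDigit m r k := by
      intro r hr j
      obtain ⟨hrq, hr⟩ := Finset.mem_erase.1 hr
      have hrp := Nat.prime_of_mem_primeFactors hr
      refine topDigit_add_of_dvd hrp (hfac r hr) k (Dvd.dvd.mul_left ?_ j)
      refine Nat.Coprime.dvd_of_dvd_mul_left (m := q)
        (Nat.Coprime.pow_left _ ((Nat.coprime_primes hrp hq).2 hrq)) ?_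
      rw [Nat.mul_div_cancel' hqm]
      exact Nat.ordProj_dvd m r
    have hterm : ∀ j : ℕ, ∏ r ∈ m.primeFactors, s r (topDigit m r (k + j * (m / q))) =
        s q (topDigit m q k + j * u) * ∏ r ∈ m.primeFactors.erase q, s r (topDigit m r k) := by
      intro j
      rw [← Finset.mul_prod_erase _ _ hmem]
      congr 1
      · rw [hmq, mul_left_comm, topDigit_add hq.pos, Nat.cast_mul]
      · exact Finset.prod_congr rfl fun r hr => by rw [hother r hr]
    simp only [hterm]
    rw [← Finset.sum_mul]
    exact (hsum q hq hqm _ _ hunit).mul_right _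

open Polynomial in
/-- The residues `τₖ = (p ± 1) / 2` that realise the extremal case. The signs `2 τₖ - p` are
chosen periodic modulo the prime-to-`p` part `m` of `n`; this suffices because
the `n`-th cyclotomic polynomial is modulo `p` a power of the `m`-th one. -/
theorem exists_near_half_residues {n p : ℕ} (hn : 0 < n) (hp : p.Prime) (hodd : Odd p) (hpn : p ∣ n)
    (hmin : ∀ q : ℕ, q.Prime → Odd q → q ∣ n → p ≤ q) :
    ∃ τ : ℕ → ℤ, (∀ k, 2 * τ k = p + 1 ∨ 2 * τ k = p - 1) ∧
      ∀ f : ℤ[X], cyclotomic n ℤ ∣ f → (p : ℤ) ∣ seqPairing τ f := by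
  have : Fact p.Prime := ⟨hp⟩
  set m := n / p ^ n.factorization p with hm
  have hmn : m ∣ n := Nat.ordCompl_dvd n p
  have hm0 : 0 < m := Nat.ordCompl_pos p hn.ne'
  have hpm : ¬ p ∣ m := Nat.not_dvd_ordCompl hp hn.ne'
  obtain ⟨s, hs, hper, hsum⟩ := exists_signs_periodic hodd hm0 fun q hq hqm =>
    hq.eq_two_or_odd'.imp_right fun h => ⟨h, hmin q hq h (hqm.trans hmn)⟩
  have hmem := seqPairing.cyclotomic_mem_recurrenceIdeal (R := ZMod p)
    (s := fun k => Int.castRingHom (ZMod p) (s k)) hm0 (fun k => by rw [hper])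
    (fun q hq hqm => by
      rw [ZMod.isUnit_iff_coprime]
      exact (Nat.coprime_primes hq hp).2 fun h => hpm (h ▸ hqm))
    (fun q hq hqm k => by
      rw [← map_sum]
      exact (ZMod.intCast_zmod_eq_zero_iff_dvd _ p).2 (hsum q hq hqm k))
  have hcyc : cyclotomic m (ZMod p) ∣ cyclotomic n (ZMod p) := by
    have hk : 0 < n.factorization p := hp.factorization_pos_of_dvd hn.ne' hpn
    have h := cyclotomic_mul_prime_pow_eq (ZMod p) hpm hk
    rw [hm, Nat.ordProj_mul_ordCompl_eq_self, ← hm] at h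
    rw [h]
    refine dvd_pow_self _ (Nat.sub_pos_of_lt ?_).ne'
    exact Nat.pow_lt_pow_right hp.one_lt (Nat.sub_lt hk one_pos)
  have htau : ∀ k, 2 * ((p + s k) / 2) = p + s k := by
    intro k
    obtain ⟨a, ha⟩ := hodd
    rcases hs k with h | h <;> rw [h] <;> omega
  refine ⟨fun k => (p + s k) / 2, fun k => ?_, fun f hf => ?_⟩
  · rw [htau]
    rcases hs k with h | h <;> rw [h]
    · exact Or.inl rfl
    · exact Or.inr rfl
  · have hfs : (p : ℤ) ∣ seqPairing s f := by
      have h1 := map_dvd (mapRingHom (Int.castRingHom (ZMod p))) hf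
      rw [coe_mapRingHom, map_cyclotomic] at h1
      have h2 := seqPairing.apply_eq_zero_of_mem
        (Ideal.mem_of_dvd _ (hcyc.trans h1) hmem)
      rw [seqPairing.map_apply] at h2
      exact (ZMod.intCast_zmod_eq_zero_iff_dvd _ p).1 h2
    have h2 : 2 * seqPairing (fun k => (p + s k) / 2) f = p * f.eval 1 + seqPairing s f := by
      rw [← seqPairing.const_mul_apply, ← seqPairing.one_apply, ← seqPairing.const_mul_apply,
        ← seqPairing.add_apply]
      simp only [htau, mul_one]
    have h3 : (p : ℤ) ∣ 2 * seqPairing (fun k => (p + s k) / 2) f := by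
      rw [h2]
      exact dvd_add (dvd_mul_right _ _) hfs
    refine IsCoprime.dvd_of_dvd_mul_left ?_ h3
    rw [Int.isCoprime_iff_gcd_eq_one]
    exact_mod_cast hodd.coprime_two_right

/-! ### The optimal bound -/

/-- The upper bound on `ε`: over a coset of the `p`-th roots of unity the numbers `Re (X ωᵏ)` sum to
zero, so that their fractional parts sum to an integer, which cannot lie strictly between
`(p - 1) / 2` and `(p + 1) / 2`. -/
theorem lt_of_fract_mem_Ioo {n p : ℕ} {ω X : ℂ} {ε : ℝ} (hω : IsPrimitiveRoot ω n) (hn : 0 < n)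
    (hp : p.Prime) (hodd : Odd p) (hpn : p ∣ n)
    (h : ∀ k : ℕ, 1 ≤ k → k ≤ n → Int.fract (X * ω ^ k).re ∈ Set.Ioo ε (1 - ε)) :
    ε < ((p : ℝ) - 1) / (2 * (p : ℝ)) := by
  obtain ⟨r, rfl⟩ := hpn
  have hr : 0 < r := Nat.pos_of_mul_pos_left hn
  have hη : IsPrimitiveRoot (ω ^ r) p := hω.pow hn (mul_comm p r)
  have hmem : ∀ j ∈ Finset.range p,
      Int.fract (X * ω ^ (r * (j + 1))).re ∈ Set.Ioo ε (1 - ε) := fun j hj =>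
    h _ (Nat.mul_pos hr j.succ_pos)
      (by rw [mul_comm p]; exact Nat.mul_le_mul_left _ (Finset.mem_range.1 hj))
  have hzero : ∑ j ∈ Finset.range p, (X * ω ^ (r * (j + 1))).re = 0 := by
    rw [← Complex.re_sum]
    have : ∑ j ∈ Finset.range p, X * ω ^ (r * (j + 1)) =
        X * ω ^ r * ∑ j ∈ Finset.range p, (ω ^ r) ^ j := by
      rw [Finset.mul_sum]
      refine Finset.sum_congr rfl fun j _ => ?_
      rw [pow_mul, pow_succ]
      ring
    rw [this, hη.geom_sum_eq_zero hp.one_lt, mul_zero, Complex.zero_re]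
  obtain ⟨z, hz⟩ : ∃ z : ℤ,
      ∑ j ∈ Finset.range p, Int.fract (X * ω ^ (r * (j + 1))).re = z := by
    refine ⟨-∑ j ∈ Finset.range p, ⌊(X * ω ^ (r * (j + 1))).re⌋, ?_⟩
    simp only [Int.fract, Finset.sum_sub_distrib, hzero]
    push_cast
    ring
  have hne : (Finset.range p).Nonempty := Finset.nonempty_range_iff.2 hp.ne_zero
  have hlo := Finset.sum_lt_sum_of_nonempty hne fun j hj => (hmem j hj).1
  have hhi := Finset.sum_lt_sum_of_nonempty hne fun j hj => (hmem j hj).2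
  rw [hz, Finset.sum_const, Finset.card_range, nsmul_eq_mul] at hlo hhi
  by_contra! hε
  have hp0 : (0 : ℝ) < p := Nat.cast_pos.2 hp.pos
  rw [div_le_iff₀ (by positivity)] at hε
  have h1 : ((p : ℤ) : ℝ) - 1 < 2 * z := by push_cast; linarith
  have h2 : 2 * (z : ℝ) < (p : ℤ) + 1 := by push_cast; linarith
  have h1' : (p : ℤ) - 1 < 2 * z := by exact_mod_cast h1
  have h2' : 2 * z < (p : ℤ) + 1 := by exact_mod_cast h2
  obtain ⟨a, ha⟩ := hodd
  omega

/-- Passing from residues `τₖ / p` that keep a distance greater than `ε` from the integers to a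
point `X`. -/
theorem exists_fract_mem_Ioo {n p : ℕ} {ω : ℂ} {ε b : ℝ} (hω : IsPrimitiveRoot ω n) (hn : 0 < n)
    (hp : 0 < p) (hε : 0 < ε) (hb : ε < b) {τ : ℕ → ℤ}
    (hτb : ∀ k, (τ k : ℝ) / p ∈ Set.Icc b (1 - b))
    (hτ : ∀ f : Polynomial ℤ, Polynomial.cyclotomic n ℤ ∣ f → (p : ℤ) ∣ seqPairing τ f) :
    ∃ X : ℂ, ∀ k : ℕ, Int.fract (X * ω ^ k).re ∈ Set.Ioo ε (1 - ε) := by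
  obtain ⟨X, hX⟩ := exists_re_mul_pow_near hn hω hp τ hτ (sub_pos.2 hb)
  refine ⟨X, fun k => ?_⟩
  obtain ⟨z, hz⟩ := hX k
  obtain ⟨h1, h2⟩ := abs_lt.1 hz
  obtain ⟨h3, h4⟩ := hτb k
  have hfr : Int.fract (X * ω ^ k).re = (X * ω ^ k).re - z :=
    Int.fract_eq_iff.2 ⟨by linarith, by linarith, z, by ring⟩
  rw [hfr]
  constructor <;> linarith

/-- Let `n > 1`, `ω = e^{2πi/n}` and `ε > 0`. There is `X ∈ ℂ` such that all the fractional parts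
`{Re (X ω^k)}`, `1 ≤ k ≤ n`, lie in the open interval `(ε, 1 - ε)` if and only if
`ε < (p - 1) / (2p)`, when `n` is not a power of `2` and `p` is its smallest odd prime divisor,
and `ε < 1/2` when `n` is a power of `2`. -/
theorem theorem1 (n : ℕ) (hn : 1 < n) (ω : ℂ)
    (hω : ω = Complex.exp (2 * (Real.pi : ℂ) * Complex.I / (n : ℂ)))
    (ε : ℝ) (hε : 0 < ε) :
    (∀ p : ℕ, IsLeast {q : ℕ | q.Prime ∧ Odd q ∧ q ∣ n} p →
      ((∃ X : ℂ, ∀ k : ℕ, 1 ≤ k → k ≤ n →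
          Int.fract (X * ω ^ k).re ∈ Set.Ioo ε (1 - ε)) ↔
        ε < ((p : ℝ) - 1) / (2 * (p : ℝ)))) ∧
    ((∃ m : ℕ, n = 2 ^ m) →
      ((∃ X : ℂ, ∀ k : ℕ, 1 ≤ k → k ≤ n →
          Int.fract (X * ω ^ k).re ∈ Set.Ioo ε (1 - ε)) ↔
        ε < 1 / 2)) := by
  have hn0 : 0 < n := one_pos.trans hn
  have hprim : IsPrimitiveRoot ω n := hω ▸ Complex.isPrimitiveRoot_exp n hn0.ne'
  constructor
  · rintro p ⟨⟨hp, hodd, hpn⟩, hmin⟩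
    refine ⟨fun ⟨X, hX⟩ => lt_of_fract_mem_Ioo hprim hn0 hp hodd hpn hX, fun hlt => ?_⟩
    obtain ⟨τ, hτ2, hτ⟩ := exists_near_half_residues hn0 hp hodd hpn
      fun q hq hqo hqn => hmin ⟨hq, hqo, hqn⟩
    have hp0 : (0 : ℝ) < p := Nat.cast_pos.2 hp.pos
    have hτb : ∀ k, (τ k : ℝ) / p ∈
        Set.Icc (((p : ℝ) - 1) / (2 * p)) (1 - ((p : ℝ) - 1) / (2 * p)) := by
      intro k
      have h : 2 * (τ k : ℝ) = p + 1 ∨ 2 * (τ k : ℝ) = p - 1 := by exact_mod_cast hτ2 k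
      have hdiv : (τ k : ℝ) / p = 2 * τ k / (2 * p) := by field_simp
      have hcompl : 1 - ((p : ℝ) - 1) / (2 * p) = (p + 1) / (2 * p) := by field_simp; ring
      rw [hcompl, hdiv, Set.mem_Icc, div_le_div_iff_of_pos_right (by positivity),
        div_le_div_iff_of_pos_right (by positivity)]
      rcases h with h | h <;> rw [h] <;> constructor <;> linarith
    obtain ⟨X, hX⟩ := exists_fract_mem_Ioo hprim hn0 hp.pos hε hlt hτb hτ
    exact ⟨X, fun k _ _ => hX k⟩
  · rintro ⟨m, rfl⟩
    constructor
    · rintro ⟨X, hX⟩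
      obtain ⟨h1, h2⟩ := hX 1 le_rfl hn.le
      linarith
    · intro hlt
      obtain ⟨k, rfl⟩ : ∃ k, m = k + 1 :=
        Nat.exists_eq_succ_of_ne_zero (by rintro rfl; simp at hn)
      obtain ⟨X, hX⟩ := exists_fract_mem_Ioo (p := 2) (τ := fun _ => 1) hprim hn0 two_pos hε hlt
        (fun k => by norm_num) (fun f hf => by
          -- The `2ᵏ⁺¹`-th cyclotomic polynomial takes the value `2` at `1`.
          have h := Polynomial.eval_dvd (x := 1) hf
          rwa [Polynomial.eval_one_cyclotomic_prime_pow, ← seqPairing.one_apply] at h)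
      exact ⟨X, fun k _ _ => hX k⟩
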